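/- Let $n\ge 1$, and let items $1,\dots,n$ have profits $c_i>0$ and success probabilities $0<p_i<1$ (real numbers). For $S\subseteq\{1,\dots,n\}$ put $v(S)=\bigl(\sum_{i\in S}c_i\bigr)\prod_{j\in S}p_j$, and let $\mathrm{OPT}=\max_S v(S)$. Given $\varepsilon>0$, Algorithm 1 works as follows. 1. Split the items into $N=\{i: p_i\ge \tfrac12\}$ and its complement $M=\{i: p_i<\tfrac12\}$. Set $z_{\max}=\max_{1\le j\le n} c_jp_j$, the best single-item solution. If $N=\emptyset$, return $z_{\max}$. 2. Let $\kappa=\varepsilon\,\max_{i\in N}p_ic_i/n$ and $\hat c_i=\lfloor c_i/\kappa\rfloor$ for all $i$. Let $\bar C=\sum_{i\in N}\hat c_i$. 3. For every $j\in M$, and for a dummy item $j$ with $\hat c_j=0$ and $p_j=1$, do the following. List $N$ as $i_1,\dots,i_h$ and compute the table $\hat P(k,C)$, $0\le k\le h$, $0\le C\le\bar C$, by $$\hat P(0,0)=1,\qquad \hat P(0,C)=0\ \ (C>0),$$ $$\hat P(k,C)=\begin{cases}\max\{\hat P(k-1,C),\ p_{i_k}\hat P(k-1,C-\hat c_{i_k})\}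 & \text{if } \hat c_{i_k}\le C,\\ \hat P(k-1,C)&\text{otherwise.}\end{cases}$$ Then compute $\hat z_j=\max\{(C+\hat c_j)\,\hat P(h,C)\,p_j:\ \min_{i\in N}\hat c_i\le C\le\bar C\}$ and replace $z_{\max}$ by $\max\{z_{\max},\kappa\hat z_j\}$. 4. Return $z_{\max}$. Then Algorithm 1 is a fully polynomial time approximation scheme for computing $\mathrm{OPT}$: for every such instance and every $\varepsilon>0$ the returned value satisfies $$(1-\varepsilon)\,\mathrm{OPT}\ \le\ z_{\max}\ \le\ \mathrm{OPT},$$ and there is an absolute constant $K$ such that for all $0<\varepsilon\le 1$ the algorithm performs at most $K n^4/\varepsilon$ elementary steps, where every arithmetic operation, rounding, comparison, memory access and loop iteration counts as one step. -/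

import Mathlib

namespace AllOrNothing

/-! ## The optimization problem -/

/-- Expected value of the subset `S`: total profit times the probability that all of `S` succeeds. -/
noncomputable def value {n : ℕ} (c p : Fin n → ℝ) (S : Finset (Fin n)) : ℝ :=
  (∑ i ∈ S, c i) * ∏ j ∈ S, p j

/-- The maximum expected value over all subsets of the items. -/
noncomputable def opt {n : ℕ} (c p : Fin n → ℝ) : ℝ :=
  (Finset.univ : Finset (Finset (Fin n))).sup' Finset.univ_nonempty (value c p)

/-! ## Cost model

Unit-cost random access machine: a computation is a result together with the number of elementary
steps spent. Every arithmetic operation, rounding, comparison, memory access and loop iteration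
costs one step; everything else only passes results on. -/

/-- A result together with the number of elementary steps used to obtain it. -/
structure Timed (α : Type) where
  val : α
  steps : ℕ

/-- Sequential composition adds the step counts. -/
instance : Monad Timed where
  pure a := ⟨a, 0⟩
  bind x f := ⟨(f x.val).val, x.steps + (f x.val).steps⟩

/-- One elementary step with result `a`. It is used only through the primitives below. -/
def step {α : Type} (a : α) : Timed α := ⟨a, 1⟩

/-- Real multiplication. -/
noncomputable def mulR (x y : ℝ) : Timed ℝ := step (x * y)

/-- Real division. -/
noncomputable def divR (x y : ℝ) : Timed ℝ := step (x / y)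

/-- Comparison of reals. -/
noncomputable def leR (x y : ℝ) : Timed Bool := step (decide (x ≤ y))

/-- Maximum of two reals. -/
noncomputable def maxR (x y : ℝ) : Timed ℝ := step (max x y)

/-- Rounding a nonnegative real down to an integer. -/
noncomputable def floorR (x : ℝ) : Timed ℕ := step ⌊x⌋₊

/-- Conversion of an integer to a real. -/
noncomputable def castR (k : ℕ) : Timed ℝ := step (k : ℝ)

/-- Integer addition. -/
def addN (a b : ℕ) : Timed ℕ := step (a + b)

/-- Integer subtraction (used only for `b ≤ a`). -/
def subN (a b : ℕ) : Timed ℕ := step (a - b)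

/-- Comparison of integers. -/
def leN (a b : ℕ) : Timed Bool := step (decide (a ≤ b))

/-- Minimum of two integers. -/
def minN (a b : ℕ) : Timed ℕ := step (min a b)

/-- Reading one cell of an array. -/
def readA {ι α : Type} (a : ι → α) (i : ι) : Timed α := step (a i)

/-- Writing one cell of an array. -/
def writeA {ι α : Type} [DecidableEq ι] (a : ι → α) (i : ι) (v : α) : Timed (ι → α) :=
  step (Function.update a i v)

/-- Putting an element in front of a list. -/
def consL {α : Type} (x : α) (l : List α) : Timed (List α) := step (x :: l)

/-- A loop over the entries of `l` with loop state `s`; each iteration costs one step in addition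
to its body. -/
def loop {ι σ : Type} (l : List ι) (s : σ) (body : ι → σ → Timed σ) : Timed σ :=
  match l with
  | [] => pure s
  | i :: l => do
      let i ← step i
      let s ← body i s
      loop l s body

/-! ## The algorithm -/

section Algorithm

variable {n : ℕ}

/-- Splits the items into those with `p i ≥ 1/2` (first list) and those with `p i < 1/2`. -/
noncomputable def splitItems (p : Fin n → ℝ) : Timed (List (Fin n) × List (Fin n)) :=
  loop (List.finRange n) ([], []) fun i s => do
    let q ← readA p i
    if ← leR (1 / 2) q then
      let l ← consL i s.1
      pure (l, s.2)
    else
      let l ← consL i s.2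
      pure (s.1, l)

/-- `z ← max z (c j * p j)`: compares the incumbent `z` with the single-item solution `{j}`. -/
noncomputable def trySingle (c p : Fin n → ℝ) (j : Fin n) (z : ℝ) : Timed ℝ := do
  let a ← readA c j
  let q ← readA p j
  let v ← mulR a q
  maxR z v

/-- The scaling factor `κ = ε * max_{i ∈ big} (p i * c i) / n`. -/
noncomputable def scaleFactor (c p : Fin n → ℝ) (ε : ℝ) (big : List (Fin n)) : Timed ℝ := do
  let m ← loop big 0 (trySingle c p)
  let a ← mulR ε m
  let N ← castR n
  divR a N

/-- The scaled profits `⌊c i / κ⌋`. -/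
noncomputable def scaleProfits (c : Fin n → ℝ) (κ : ℝ) : Timed (Fin n → ℕ) :=
  loop (List.finRange n) (fun _ => 0) fun i ch => do
    let a ← readA c i
    let b ← divR a κ
    let w ← floorR b
    writeA ch i w

/-- The sum of the scaled profits of the items in `big`. -/
def sumProfits (ch : Fin n → ℕ) (big : List (Fin n)) : Timed ℕ :=
  loop big 0 fun i t => do
    let w ← readA ch i
    addN t w

/-- The minimum of `a` and the scaled profits of the items in `big`. -/
def minProfit (ch : Fin n → ℕ) (big : List (Fin n)) (a : ℕ) : Timed ℕ :=
  loop big a fun i t => do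
    let w ← readA ch i
    minN t w

/-- The row of the dynamic program for no items: entry `1` at profit `0`, and `0` at the
profits `1, …, B`. -/
noncomputable def initialRow (B : ℕ) : Timed (ℕ → ℝ) :=
  loop (List.range (B + 1)) (fun _ => 0) fun C row => do
    if ← leN C 0 then writeA row C 1 else writeA row C 0

/-- One stage of the dynamic program, adding item `i`: for `C = 0, …, B`,
`new C = max (old C) (p i * old (C - ch i))` if `ch i ≤ C`, and `new C = old C` otherwise. -/
noncomputable def dpStage (ch : Fin n → ℕ) (p : Fin n → ℝ) (B : ℕ) (i : Fin n) (old : ℕ → ℝ) :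
    Timed (ℕ → ℝ) := do
  let w ← readA ch i
  let q ← readA p i
  loop (List.range (B + 1)) (fun _ => 0) fun C new => do
    let a ← readA old C
    if ← leN w C then
      let d ← subN C w
      let b ← readA old d
      let b ← mulR q b
      let v ← maxR a b
      writeA new C v
    else
      writeA new C a

/-- The scaled dynamic program over the items in `big`, with an extra item of scaled profit `w` and
probability `q` forced into the solution. With `P C` the final row, it returns the maximum of
`(C + w) * P C * q` over `C = (min of ch on big), …, (sum of ch on big)`. -/
noncomputable def scaledDP (ch : Fin n → ℕ) (p : Fin n → ℝ) (big : List (Fin n)) (w : ℕ) (q : ℝ) :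
    Timed ℝ := do
  let B ← sumProfits ch big
  let lo ← minProfit ch big B
  let row ← initialRow B
  let row ← loop big row (dpStage ch p B)
  loop (List.range' lo (B + 1 - lo)) 0 fun C z => do
    let t ← addN C w
    let t ← castR t
    let a ← readA row C
    let v ← mulR t a
    let v ← mulR v q
    maxR z v

/-- The approximation scheme. The incumbent `z` starts at `0` and runs through
* all single-item solutions;
* if some item has `p i ≥ 1/2`: the values `κ * ẑ j`, where `ẑ j` is the optimum of the scaled
  dynamic program over the items with `p i ≥ 1/2` together with the extra item `j`, for every item
  `j` with `p j < 1/2` and for a dummy item of profit `0` and probability `1`.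

Without items of probability at least `1/2` there is no `κ` and nothing to run the dynamic
program on. -/
noncomputable def approxScheme (c p : Fin n → ℝ) (ε : ℝ) : Timed ℝ := do
  let (big, small) ← splitItems p
  let z ← loop small 0 (trySingle c p)
  let z ← loop big z (trySingle c p)
  match big with
  | [] => pure z
  | _ :: _ =>
      let κ ← scaleFactor c p ε big
      let ch ← scaleProfits c κ
      let z ← loop small z fun j z => do
        let w ← readA ch j
        let q ← readA p j
        let v ← scaledDP ch p big w q
        let v ← mulR κ v
        maxR z v
      let v ← scaledDP ch p big 0 1
      let v ← mulR κ v
      maxR z v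

end Algorithm

end AllOrNothing

/-!
An item with `p i < 1/2` stays in an optimal set `S` only if it carries more than half of the total
profit of `S`, since otherwise removing it would increase the value. So an optimal set contains at
most one such item, and guessing it leaves a selection among the items with `p i ≥ 1/2`. Rounding
the profits down to multiples of `κ` costs a set at most `n * κ = ε * max_{p i ≥ 1/2} (p i * c i)`,
which is at most `ε * OPT`. On the other hand `c i ≤ 2 * (p i * c i)` for `p i ≥ 1/2`, so every
scaled profit in the dynamic program is at most `2 * n / ε`, and the table has only `O(n ^ 2 / ε)`
columns.
-/

namespace AllOrNothing

open Finset

/-! ## Timed computations and loops -/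

@[simp] theorem Timed.bind_val {α β : Type} (x : Timed α) (f : α → Timed β) :
    (x >>= f).val = (f x.val).val := rfl

@[simp] theorem Timed.bind_steps {α β : Type} (x : Timed α) (f : α → Timed β) :
    (x >>= f).steps = x.steps + (f x.val).steps := rfl

@[simp] theorem Timed.pure_val {α : Type} (a : α) : (pure a : Timed α).val = a := rfl

@[simp] theorem Timed.pure_steps {α : Type} (a : α) : (pure a : Timed α).steps = 0 := rfl

@[simp] theorem step_val {α : Type} (a : α) : (step a).val = a := rfl

@[simp] theorem step_steps {α : Type} (a : α) : (step a).steps = 1 := rfl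

section Loop

variable {ι σ : Type}

theorem loop_val (l : List ι) (s : σ) (body : ι → σ → Timed σ) :
    (loop l s body).val = l.foldl (fun s i => (body i s).val) s := by
  induction l generalizing s with
  | nil => rfl
  | cons i l ih => simp [loop, ih]

theorem loop_steps_le (l : List ι) (s : σ) {body : ι → σ → Timed σ} {k : ℕ}
    (hbody : ∀ i s, (body i s).steps ≤ k) : (loop l s body).steps ≤ l.length * (k + 1) := by
  induction l generalizing s with
  | nil => simp [loop]
  | cons i l ih =>
    have hhead := hbody i s
    have htail := ih (body i s).val
    simp only [loop, Timed.bind_steps, step_steps, step_val, List.length_cons]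
    linarith

/-- Invariant rule for loops without repeated entries: `P D s` says that the entries in `D` have
been processed and have led to the state `s`. -/
theorem loop_val_induction [DecidableEq ι] {P : Finset ι → σ → Prop} {l : List ι} (hl : l.Nodup)
    {s : σ} {body : ι → σ → Timed σ} (init : P ∅ s)
    (next : ∀ i ∈ l, ∀ D s, i ∉ D → P D s → P (insert i D) (body i s).val) :
    P l.toFinset (loop l s body).val := by
  rw [loop_val]
  induction l using List.reverseRecOn with
  | nil => simpa using init
  | append_singleton l i ih =>
    obtain ⟨hl, hi⟩ : l.Nodup ∧ i ∉ l := by simpa [and_comm] using List.nodup_append'.1 hl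
    have hstep := next i (by simp) l.toFinset _ (by simpa using hi)
      (ih hl fun j hj => next j (by simp [hj]))
    simpa using hstep

theorem loop_update_val {α : Type} [DecidableEq ι] (l : List ι) (a : ι → α)
    {body : ι → (ι → α) → Timed (ι → α)} {g : ι → α}
    (hbody : ∀ i a, (body i a).val = Function.update a i (g i)) (j : ι) :
    (loop l a body).val j = if j ∈ l then g j else a j := by
  rw [loop_val]
  induction l generalizing a with
  | nil => simp
  | cons i l ih =>
    rw [List.foldl_cons, ih, hbody]
    by_cases hj : j = i
    · subst hj; simp
    · simp [hj]

theorem loop_sup_val_le_iff [SemilatticeSup σ] (l : List ι) (s x : σ) {body : ι → σ → Timed σ}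
    {f : ι → σ} (hbody : ∀ i s, (body i s).val = s ⊔ f i) :
    (loop l s body).val ≤ x ↔ s ≤ x ∧ ∀ i ∈ l, f i ≤ x := by
  rw [loop_val]
  induction l generalizing s with
  | nil => simp
  | cons i l ih => rw [List.foldl_cons, ih, hbody, sup_le_iff, List.forall_mem_cons, and_assoc]

theorem le_loop_inf_val_iff [SemilatticeInf σ] (l : List ι) (s x : σ) {body : ι → σ → Timed σ}
    {f : ι → σ} (hbody : ∀ i s, (body i s).val = s ⊓ f i) :
    x ≤ (loop l s body).val ↔ x ≤ s ∧ ∀ i ∈ l, x ≤ f i :=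
  loop_sup_val_le_iff (σ := σᵒᵈ) l s x hbody

theorem loop_partition_val (P : ι → Prop) [DecidablePred P] (l : List ι) (s : List ι × List ι)
    {body : ι → List ι × List ι → Timed (List ι × List ι)}
    (hbody : ∀ i s, (body i s).val = if P i then (i :: s.1, s.2) else (s.1, i :: s.2)) :
    (loop l s body).val =
      ((l.filter (P ·)).reverse ++ s.1, (l.filter (¬ P ·)).reverse ++ s.2) := by
  rw [loop_val]
  induction l generalizing s with
  | nil => simp
  | cons i l ih =>
    rw [List.foldl_cons, ih, hbody]
    by_cases hi : P i <;> simp [hi]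

end Loop

/-! ## Values and optimal sets -/

section Opt

variable {n : ℕ} {c p : Fin n → ℝ} {S T : Finset (Fin n)} {i j : Fin n}

theorem value_empty (c p : Fin n → ℝ) : value c p ∅ = 0 := by
  simp [value]

theorem value_singleton (c p : Fin n → ℝ) (j : Fin n) : value c p {j} = c j * p j := by
  simp [value]

theorem value_insert (c p : Fin n → ℝ) (hj : j ∉ T) :
    value c p (insert j T) = (∑ i ∈ T, c i + c j) * (∏ i ∈ T, p i) * p j := by
  rw [value, sum_insert hj, prod_insert hj]
  ring

theorem value_le_opt (c p : Fin n → ℝ) (S : Finset (Fin n)) : value c p S ≤ opt c p :=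
  le_sup' (value c p) (mem_univ S)

theorem opt_nonneg (c p : Fin n → ℝ) : 0 ≤ opt c p :=
  value_empty c p ▸ value_le_opt c p ∅

theorem exists_value_eq_opt (c p : Fin n → ℝ) : ∃ S, value c p S = opt c p := by
  obtain ⟨S, -, hS⟩ := exists_mem_eq_sup' univ_nonempty (value c p)
  exact ⟨S, hS.symm⟩

theorem sum_lt_two_mul_of_value_erase_le (hc : ∀ i, 0 < c i) (hp : ∀ i, 0 < p i)
    (hi : i ∈ S) (hpi : p i < 1 / 2) (hle : value c p (S.erase i) ≤ value c p S) :
    ∑ k ∈ S, c k < 2 * c i := by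
  have hsum : 0 < ∑ k ∈ S, c k := sum_pos (fun k _ => hc k) ⟨i, hi⟩
  have hprod : 0 < ∏ k ∈ S.erase i, p k := prod_pos fun k _ => hp k
  have hcancel : ∑ k ∈ S.erase i, c k ≤ (∑ k ∈ S, c k) * p i := by
    rwa [value, value, ← mul_prod_erase S p hi, ← mul_assoc, mul_le_mul_iff_left₀ hprod] at hle
  have hhalf : (∑ k ∈ S, c k) * p i < (∑ k ∈ S, c k) * (1 / 2) := by gcongr
  linarith [add_sum_erase S c hi]

theorem eq_of_mem_of_value_eq_opt (hc : ∀ i, 0 < c i) (hp : ∀ i, 0 < p i)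
    (hS : value c p S = opt c p) (hi : i ∈ S) (hj : j ∈ S) (hpi : p i < 1 / 2)
    (hpj : p j < 1 / 2) : i = j := by
  by_contra hne
  have hmax (k : Fin n) : value c p (S.erase k) ≤ value c p S := hS ▸ value_le_opt c p _
  have hltᵢ := sum_lt_two_mul_of_value_erase_le hc hp hi hpi (hmax i)
  have hltⱼ := sum_lt_two_mul_of_value_erase_le hc hp hj hpj (hmax j)
  have hpair : c i + c j ≤ ∑ k ∈ S, c k :=
    sum_pair (f := c) hne ▸ sum_le_sum_of_subset_of_nonneg
      (by simp [insert_subset_iff, hi, hj]) fun k _ _ => (hc k).le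
  linarith

theorem exists_eq_or_eq_insert_of_value_eq_opt (hc : ∀ i, 0 < c i) (hp : ∀ i, 0 < p i)
    (hS : value c p S = opt c p) :
    ∃ T : Finset (Fin n), (∀ i ∈ T, 1 / 2 ≤ p i) ∧
      (S = T ∨ ∃ j, p j < 1 / 2 ∧ S = insert j T) := by
  refine ⟨{i ∈ S | 1 / 2 ≤ p i}, fun i hi => (mem_filter.1 hi).2, ?_⟩
  by_cases! hsmall : ∃ j ∈ S, p j < 1 / 2
  · obtain ⟨j, hj, hpj⟩ := hsmall
    refine Or.inr ⟨j, hpj, Finset.ext fun i => ?_⟩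
    have hunique : i ∈ S → p i < 1 / 2 → i = j := fun hi hpi =>
      eq_of_mem_of_value_eq_opt hc hp hS hi hj hpi hpj
    grind
  · exact Or.inl (filter_true_of_mem hsmall).symm

end Opt

/-! ## Rounding the profits -/

/-- The profits rounded down to integer multiples of `κ`, in units of `κ`, written `ĉ` in the
paper. -/
noncomputable def floorProfits {n : ℕ} (c : Fin n → ℝ) (κ : ℝ) : Fin n → ℕ := fun i => ⌊c i / κ⌋₊

section Rounding

variable {n : ℕ} {c p : Fin n → ℝ} {κ : ℝ}

theorem mul_value_floorProfits_le (hκ : 0 < κ) (hc : ∀ i, 0 ≤ c i) (hp : ∀ i, 0 ≤ p i)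
    (S : Finset (Fin n)) : κ * value (fun i => floorProfits c κ i) p S ≤ value c p S := by
  have hfloor (i : Fin n) : κ * floorProfits c κ i ≤ c i := by
    rw [mul_comm, ← le_div_iff₀ hκ]
    exact Nat.floor_le (div_nonneg (hc i) hκ.le)
  rw [value, value, ← mul_assoc, mul_sum]
  gcongr with i
  · exact prod_nonneg fun i _ => hp i
  · exact hfloor i

theorem value_le_mul_value_floorProfits_add (hκ : 0 < κ) (hp0 : ∀ i, 0 ≤ p i)
    (hp1 : ∀ i, p i ≤ 1) (S : Finset (Fin n)) :
    value c p S ≤ κ * value (fun i => floorProfits c κ i) p S + n * κ := by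
  have hfloor (i : Fin n) : c i ≤ κ * floorProfits c κ i + κ := by
    rw [← mul_add_one, mul_comm, ← div_le_iff₀ hκ]
    exact (Nat.lt_floor_add_one _).le
  have hsum : ∑ i ∈ S, c i ≤ κ * ∑ i ∈ S, (floorProfits c κ i : ℝ) + #S * κ := by
    rw [mul_sum, ← nsmul_eq_mul, ← sum_const, ← sum_add_distrib]
    exact sum_le_sum fun i _ => hfloor i
  have hprod0 : 0 ≤ ∏ i ∈ S, p i := prod_nonneg fun i _ => hp0 i
  have hprod1 : ∏ i ∈ S, p i ≤ 1 := prod_le_one (fun i _ => hp0 i) fun i _ => hp1 i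
  calc value c p S
      ≤ (κ * ∑ i ∈ S, (floorProfits c κ i : ℝ) + #S * κ) * ∏ i ∈ S, p i := by
        unfold value; gcongr
    _ = κ * value (fun i => floorProfits c κ i) p S + #S * κ * ∏ i ∈ S, p i := by
        unfold value; ring
    _ ≤ κ * value (fun i => floorProfits c κ i) p S + n * κ * 1 := by
        gcongr; exact card_finset_fin_le S
    _ = κ * value (fun i => floorProfits c κ i) p S + n * κ := by rw [mul_one]

end Rounding

/-! ## The dynamic program -/

section Bellman

variable {ι : Type*} {w : ι → ℕ} {p : ι → ℝ} {D : Finset ι} {i : ι} {C : ℕ}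

/-- The success probabilities of the subsets of `D` of total profit exactly `C`, together with the
entry `0` by which the dynamic program encodes that there is no such subset. -/
def successProbs (w : ι → ℕ) (p : ι → ℝ) (D : Finset ι) (C : ℕ) : Set ℝ :=
  insert 0 {x | ∃ T ⊆ D, ∑ i ∈ T, w i = C ∧ ∏ i ∈ T, p i = x}

theorem prod_mem_successProbs {T : Finset ι} (w : ι → ℕ) (p : ι → ℝ) (hT : T ⊆ D) :
    ∏ i ∈ T, p i ∈ successProbs w p D (∑ i ∈ T, w i) :=
  Or.inr ⟨T, hT, rfl, rfl⟩

theorem isGreatest_successProbs_empty (w : ι → ℕ) (p : ι → ℝ) (C : ℕ) :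
    IsGreatest (successProbs w p ∅ C) (if C = 0 then 1 else 0) := by
  have hmem (x : ℝ) : x ∈ successProbs w p ∅ C ↔ x = 0 ∨ C = 0 ∧ x = 1 := by
    simp [successProbs, subset_empty, eq_comm]
  split_ifs with hC
  · refine ⟨(hmem 1).2 (Or.inr ⟨hC, rfl⟩), fun x hx => ?_⟩
    rcases (hmem x).1 hx with rfl | ⟨-, rfl⟩
    exacts [zero_le_one, le_rfl]
  · exact ⟨Or.inl rfl, fun x hx => (((hmem x).1 hx).resolve_right fun h => hC h.1).le⟩

variable [DecidableEq ι]

theorem successProbs_insert_of_lt (hC : C < w i) :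
    successProbs w p (insert i D) C = successProbs w p D C := by
  refine congrArg (insert 0) (Set.ext fun x => exists_congr fun T =>
    and_congr_left fun ⟨hsum, _⟩ => subset_insert_iff_of_notMem fun hi => ?_)
  exact (hsum ▸ single_le_sum (fun _ _ => Nat.zero_le _) hi : w i ≤ C).not_gt hC

theorem successProbs_insert_of_le (hi : i ∉ D) (hC : w i ≤ C) :
    successProbs w p (insert i D) C =
      successProbs w p D C ∪ (p i * ·) '' successProbs w p D (C - w i) := by
  apply Set.Subset.antisymm
  · rintro _ (rfl | ⟨T, hT, rfl, rfl⟩)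
    · exact Or.inl (Or.inl rfl)
    by_cases hiT : i ∈ T
    · have hrest : ∑ k ∈ T.erase i, w k = ∑ k ∈ T, w k - w i := by
        rw [← add_sum_erase T w hiT, Nat.add_sub_cancel_left]
      exact Or.inr ⟨_, Or.inr ⟨T.erase i, subset_insert_iff.1 hT, hrest, rfl⟩,
        mul_prod_erase T p hiT⟩
    · exact Or.inl (prod_mem_successProbs w p ((subset_insert_iff_of_notMem hiT).1 hT))
  · rintro _ ((rfl | ⟨T, hT, rfl, rfl⟩) | ⟨_, rfl | ⟨T, hT, hsum, rfl⟩, rfl⟩)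
    · exact Or.inl rfl
    · exact prod_mem_successProbs w p (hT.trans (subset_insert i D))
    · exact Or.inl (mul_zero _)
    · have hiT : i ∉ T := fun h => hi (hT h)
      refine Or.inr ⟨insert i T, insert_subset_insert i hT, ?_, prod_insert hiT⟩
      rw [sum_insert hiT, hsum, Nat.add_sub_of_le hC]

end Bellman

section DynamicProgram

variable {n : ℕ} {p : Fin n → ℝ} {ch : Fin n → ℕ} {big : List (Fin n)} {T : Finset (Fin n)}

theorem sumProfits_val (ch : Fin n → ℕ) (big : List (Fin n)) :
    (sumProfits ch big).val = (big.map ch).sum := by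
  rw [sumProfits, loop_val, List.sum_eq_foldl, List.foldl_map]
  rfl

theorem minProfit_val_le (ch : Fin n → ℕ) (a : ℕ) {i : Fin n} (hi : i ∈ big) :
    (minProfit ch big a).val ≤ ch i :=
  ((le_loop_inf_val_iff big a _ fun _ _ => rfl).1 le_rfl).2 i hi

theorem initialRow_val {B C : ℕ} (hC : C ≤ B) : (initialRow B).val C = if C = 0 then 1 else 0 := by
  rw [initialRow, loop_update_val (g := fun C => if C = 0 then 1 else 0)]
  · simp [Nat.lt_succ_of_le hC]
  · intro C row
    by_cases h : C = 0 <;> simp [leN, writeA, h]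

theorem dpStage_val (ch : Fin n → ℕ) (p : Fin n → ℝ) {B C : ℕ} (i : Fin n) (old : ℕ → ℝ)
    (hC : C ≤ B) : (dpStage ch p B i old).val C =
      if ch i ≤ C then max (old C) (p i * old (C - ch i)) else old C := by
  simp only [dpStage, Timed.bind_val, readA, step_val]
  rw [loop_update_val
    (g := fun C => if ch i ≤ C then max (old C) (p i * old (C - ch i)) else old C)]
  · simp [Nat.lt_succ_of_le hC]
  · intro C new
    by_cases h : ch i ≤ C <;> simp [leN, writeA, subN, mulR, maxR, h]

/-- The final row of the dynamic program over the items in `big` with columns `0, …, B`,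
written `P̂(h, ·)` in the paper. -/
noncomputable def dpRow (ch : Fin n → ℕ) (p : Fin n → ℝ) (big : List (Fin n)) (B : ℕ) : ℕ → ℝ :=
  (loop big (initialRow B).val (dpStage ch p B)).val

theorem isGreatest_successProbs_dpRow (ch : Fin n → ℕ) (hp : ∀ i, 0 ≤ p i) (hbig : big.Nodup)
    {B : ℕ} : ∀ C ≤ B, IsGreatest (successProbs ch p big.toFinset C) (dpRow ch p big B C) := by
  refine loop_val_induction
    (P := fun D (row : ℕ → ℝ) => ∀ C ≤ B, IsGreatest (successProbs ch p D C) (row C)) hbig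
    (fun C hC => ?_) fun i _ D row hi hrow C hC => ?_
  · rw [initialRow_val hC]
    exact isGreatest_successProbs_empty ch p C
  · rw [dpStage_val ch p i row hC]
    split_ifs with hle
    · rw [successProbs_insert_of_le hi hle]
      exact (hrow C hC).union
        ((monotone_mul_left_of_nonneg (hp i)).map_isGreatest (hrow _ ((Nat.sub_le _ _).trans hC)))
    · rw [successProbs_insert_of_lt (not_le.1 hle)]
      exact hrow C hC

/-- The body of the last loop of `scaledDP`. -/
noncomputable def tryColumn (row : ℕ → ℝ) (w : ℕ) (q : ℝ) (C : ℕ) (z : ℝ) : Timed ℝ := do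
  let t ← addN C w
  let t ← castR t
  let a ← readA row C
  let v ← mulR t a
  let v ← mulR v q
  maxR z v

theorem scaledDP_val_le_iff (ch : Fin n → ℕ) (p : Fin n → ℝ) (big : List (Fin n)) (w : ℕ)
    (q x : ℝ) : (scaledDP ch p big w q).val ≤ x ↔
      0 ≤ x ∧ ∀ C, (minProfit ch big (big.map ch).sum).val ≤ C → C ≤ (big.map ch).sum →
        ((C + w : ℕ) : ℝ) * dpRow ch p big (big.map ch).sum C * q ≤ x := by
  rw [← sumProfits_val ch big]
  refine (loop_sup_val_le_iff _ _ _ fun _ _ => rfl).trans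
    (and_congr_right fun _ => forall_congr' fun C => ?_)
  rw [List.mem_range'_1, ← and_imp]
  exact imp_congr_left (by omega)

theorem scaledDP_val_le (hp : ∀ i, 0 ≤ p i) (hbig : big.Nodup) {w : ℕ} {q x : ℝ} (hx : 0 ≤ x)
    (hle : ∀ T ⊆ big.toFinset, (∑ i ∈ T, (ch i : ℝ) + w) * (∏ i ∈ T, p i) * q ≤ x) :
    (scaledDP ch p big w q).val ≤ x := by
  refine (scaledDP_val_le_iff ch p big w q x).2 ⟨hx, fun C _ hC => ?_⟩
  rcases (isGreatest_successProbs_dpRow ch hp hbig C hC).1 with hzero | ⟨T, hT, rfl, hprod⟩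
  · simpa [hzero] using hx
  · simpa [← hprod] using hle T hT

theorem le_scaledDP_val (hp : ∀ i, 0 ≤ p i) (hbig : big.Nodup) (w : ℕ) {q : ℝ} (hq : 0 ≤ q)
    (hT : T ⊆ big.toFinset) (hne : T.Nonempty) :
    (∑ i ∈ T, (ch i : ℝ) + w) * (∏ i ∈ T, p i) * q ≤ (scaledDP ch p big w q).val := by
  obtain ⟨i, hi⟩ := hne
  have hmin : (minProfit ch big (big.map ch).sum).val ≤ ∑ i ∈ T, ch i :=
    (minProfit_val_le ch _ (List.mem_toFinset.1 (hT hi))).trans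
      (single_le_sum (fun _ _ => Nat.zero_le _) hi)
  have hsum : ∑ i ∈ T, ch i ≤ (big.map ch).sum :=
    List.sum_toFinset ch hbig ▸ sum_le_sum_of_subset hT
  have hrow := (isGreatest_successProbs_dpRow ch hp hbig _ hsum).2 (prod_mem_successProbs ch p hT)
  have hcolumn := ((scaledDP_val_le_iff ch p big w q _).1 le_rfl).2 _ hmin hsum
  push_cast at hcolumn
  exact le_trans (by gcongr) hcolumn

end DynamicProgram

/-! ## The approximation scheme -/

section Scheme

variable {n : ℕ}

/-- The list `N` of the items of success probability at least `1/2`, in the order in which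
`splitItems` returns it. -/
noncomputable def bigItems (p : Fin n → ℝ) : List (Fin n) :=
  ((List.finRange n).filter (1 / 2 ≤ p ·)).reverse

/-- The list `M` of the items of success probability less than `1/2`, in the order in which
`splitItems` returns it. -/
noncomputable def smallItems (p : Fin n → ℝ) : List (Fin n) :=
  ((List.finRange n).filter (¬ 1 / 2 ≤ p ·)).reverse

/-- The value of the best single item in `l`, and `0` if `l` is empty. -/
noncomputable def bestSingle (c p : Fin n → ℝ) (l : List (Fin n)) : ℝ :=
  (loop l 0 (trySingle c p)).val

/-- The scaling factor `κ` for the list `big`. -/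
noncomputable def scale (c p : Fin n → ℝ) (ε : ℝ) (big : List (Fin n)) : ℝ :=
  ε * bestSingle c p big / n

/-- The body of the last loop of `approxScheme`. -/
noncomputable def tryScaledDP (κ : ℝ) (ch : Fin n → ℕ) (p : Fin n → ℝ) (big : List (Fin n))
    (j : Fin n) (z : ℝ) : Timed ℝ := do
  let w ← readA ch j
  let q ← readA p j
  let v ← scaledDP ch p big w q
  let v ← mulR κ v
  maxR z v

/-- Steps 2 and 3 of the algorithm, started with the incumbent `z`. -/
noncomputable def dpPhase (c p : Fin n → ℝ) (ε : ℝ) (big small : List (Fin n)) (z : ℝ) :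
    Timed ℝ := do
  let κ ← scaleFactor c p ε big
  let ch ← scaleProfits c κ
  let z ← loop small z (tryScaledDP κ ch p big)
  let v ← scaledDP ch p big 0 1
  let v ← mulR κ v
  maxR z v

variable {c p : Fin n → ℝ} {ε : ℝ} {l : List (Fin n)} {T : Finset (Fin n)}
  {i j : Fin n}

theorem mem_bigItems : i ∈ bigItems p ↔ 1 / 2 ≤ p i := by
  simp [bigItems]

theorem mem_smallItems : i ∈ smallItems p ↔ p i < 1 / 2 := by
  simp [smallItems]

theorem mem_smallItems_or_mem_bigItems (p : Fin n → ℝ) (i : Fin n) :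
    i ∈ smallItems p ∨ i ∈ bigItems p := by
  rw [mem_smallItems, mem_bigItems]
  exact lt_or_ge _ _

theorem nodup_bigItems (p : Fin n → ℝ) : (bigItems p).Nodup :=
  List.nodup_reverse.2 ((List.nodup_finRange n).filter _)

theorem length_bigItems_add_length_smallItems (p : Fin n → ℝ) :
    (bigItems p).length + (smallItems p).length = n := by
  simp only [bigItems, smallItems, List.length_reverse, decide_not]
  exact (List.length_eq_length_filter_add _).symm.trans List.length_finRange

theorem splitItems_val (p : Fin n → ℝ) : (splitItems p).val = (bigItems p, smallItems p) := by
  rw [splitItems, loop_partition_val (1 / 2 ≤ p ·)]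
  · simp only [bigItems, smallItems, List.append_nil]
  · intro i s
    by_cases hi : 1 / 2 ≤ p i <;> simp only [Timed.bind_val, readA, leR, step_val, hi] <;> rfl

theorem scaleProfits_val (c : Fin n → ℝ) (κ : ℝ) : (scaleProfits c κ).val = floorProfits c κ := by
  ext i
  rw [scaleProfits, loop_update_val (g := floorProfits c κ) _ _ fun _ _ => rfl]
  simp

theorem approxScheme_eq (c p : Fin n → ℝ) (ε : ℝ) : approxScheme c p ε = (do
    let _ ← splitItems p
    let z ← loop (smallItems p) 0 (trySingle c p)
    let z ← loop (bigItems p) z (trySingle c p)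
    if bigItems p = [] then pure z else dpPhase c p ε (bigItems p) (smallItems p) z) := by
  simp only [approxScheme, bind, splitItems_val]
  cases bigItems p <;> rfl

theorem loop_trySingle_val_le_iff (c p : Fin n → ℝ) (l : List (Fin n)) (z x : ℝ) :
    (loop l z (trySingle c p)).val ≤ x ↔ z ≤ x ∧ ∀ j ∈ l, value c p {j} ≤ x := by
  simp only [value_singleton]
  exact loop_sup_val_le_iff l z x fun _ _ => rfl

theorem dpPhase_val_le_iff (c p : Fin n → ℝ) (ε : ℝ) (big small : List (Fin n)) (z x : ℝ) :
    (dpPhase c p ε big small z).val ≤ x ↔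
      letI κ := scale c p ε big
      letI ch := floorProfits c κ
      z ≤ x ∧ (∀ j ∈ small, κ * (scaledDP ch p big (ch j) (p j)).val ≤ x) ∧
        κ * (scaledDP ch p big 0 1).val ≤ x := by
  rw [← scaleProfits_val, ← and_assoc]
  exact max_le_iff.trans (and_congr_left' (loop_sup_val_le_iff small z x fun _ _ => rfl))

theorem approxScheme_val_le_iff (c p : Fin n → ℝ) (ε x : ℝ) :
    (approxScheme c p ε).val ≤ x ↔
      letI κ := scale c p ε (bigItems p)
      letI ch := floorProfits c κ
      0 ≤ x ∧ (∀ j, value c p {j} ≤ x) ∧ (bigItems p ≠ [] →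
        (∀ j ∈ smallItems p, κ * (scaledDP ch p (bigItems p) (ch j) (p j)).val ≤ x) ∧
          κ * (scaledDP ch p (bigItems p) 0 1).val ≤ x) := by
  have hsingle : (∀ j, value c p {j} ≤ x) ↔
      (∀ j ∈ smallItems p, value c p {j} ≤ x) ∧ ∀ j ∈ bigItems p, value c p {j} ≤ x := by
    simp only [← forall_and, ← or_imp, mem_smallItems_or_mem_bigItems, true_imp_iff]
  rw [approxScheme_eq, hsingle]
  simp only [Timed.bind_val]
  split_ifs with hbig
  · simp only [Timed.pure_val, loop_trySingle_val_le_iff, hbig, ne_eq, not_true, false_imp_iff,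
      and_true, and_assoc]
  · simp only [dpPhase_val_le_iff, loop_trySingle_val_le_iff, hbig, ne_eq, not_false_iff,
      true_imp_iff, and_assoc]

/-! ## The scaling factor -/

theorem bestSingle_nonneg (c p : Fin n → ℝ) (l : List (Fin n)) : 0 ≤ bestSingle c p l :=
  ((loop_trySingle_val_le_iff c p l 0 _).1 le_rfl).1

theorem value_singleton_le_bestSingle (c p : Fin n → ℝ) (hj : j ∈ l) :
    value c p {j} ≤ bestSingle c p l :=
  ((loop_trySingle_val_le_iff c p l 0 _).1 le_rfl).2 j hj

theorem bestSingle_le_opt (c p : Fin n → ℝ) (l : List (Fin n)) : bestSingle c p l ≤ opt c p :=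
  (loop_trySingle_val_le_iff c p l 0 _).2 ⟨opt_nonneg c p, fun _ _ => value_le_opt c p _⟩

theorem scale_pos (hc : ∀ i, 0 < c i) (hp : ∀ i, 0 < p i) (hε : 0 < ε) (hl : l ≠ []) :
    0 < scale c p ε l := by
  obtain ⟨i, hi⟩ := List.exists_mem_of_ne_nil l hl
  have hn : (0 : ℝ) < n := Nat.cast_pos.2 i.pos
  have hbest : 0 < bestSingle c p l :=
    (value_singleton c p i ▸ mul_pos (hc i) (hp i)).trans_le (value_singleton_le_bestSingle c p hi)
  unfold scale
  positivity

theorem natCast_mul_scale_le (c p : Fin n → ℝ) (hε : 0 ≤ ε) (l : List (Fin n)) :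
    n * scale c p ε l ≤ ε * opt c p :=
  calc n * scale c p ε l = ε * bestSingle c p l * (n / n) := by unfold scale; ring
    _ ≤ ε * bestSingle c p l :=
      mul_le_of_le_one_right (mul_nonneg hε (bestSingle_nonneg c p l)) (div_self_le_one _)
    _ ≤ ε * opt c p := by gcongr; exact bestSingle_le_opt c p l

theorem floorProfits_scale_le (hc : ∀ i, 0 < c i) (hp : ∀ i, 0 < p i) (hε : 0 < ε) (hi : i ∈ l)
    (hpi : 1 / 2 ≤ p i) : floorProfits c (scale c p ε l) i ≤ ⌊2 * n / ε⌋₊ := by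
  have hn : (0 : ℝ) < n := Nat.cast_pos.2 i.pos
  have hprofit : c i ≤ 2 * bestSingle c p l := by
    have hsingle := value_singleton_le_bestSingle c p hi
    rw [value_singleton] at hsingle
    nlinarith [hc i]
  refine Nat.floor_mono ((div_le_iff₀ (scale_pos hc hp hε (List.ne_nil_of_mem hi))).2 ?_)
  calc c i ≤ 2 * bestSingle c p l := hprofit
    _ = 2 * n / ε * scale c p ε l := by unfold scale; field_simp

theorem sum_floorProfits_bigItems_le (hc : ∀ i, 0 < c i) (hp : ∀ i, 0 < p i) (hε : 0 < ε) :
    (((bigItems p).map (floorProfits c (scale c p ε (bigItems p)))).sum : ℝ) ≤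
      2 * n ^ 2 / ε := by
  have hsum := List.sum_le_card_nsmul
    ((bigItems p).map (floorProfits c (scale c p ε (bigItems p)))) ⌊2 * n / ε⌋₊
    (List.forall_mem_map.2 fun i hi => floorProfits_scale_le hc hp hε hi (mem_bigItems.1 hi))
  rw [List.length_map, smul_eq_mul] at hsum
  have hlength : (bigItems p).length ≤ n :=
    (Nat.le_add_right _ _).trans_eq (length_bigItems_add_length_smallItems p)
  calc (((bigItems p).map (floorProfits c (scale c p ε (bigItems p)))).sum : ℝ)
      ≤ (bigItems p).length * ⌊2 * n / ε⌋₊ := by exact_mod_cast hsum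
    _ ≤ n * (2 * n / ε) := by gcongr; exact Nat.floor_le (by positivity)
    _ = 2 * n ^ 2 / ε := by ring

/-! ## The approximation guarantee -/

theorem approxScheme_val_le_opt (hc : ∀ i, 0 < c i) (hp : ∀ i, 0 < p i) (hε : 0 < ε) :
    (approxScheme c p ε).val ≤ opt c p := by
  refine (approxScheme_val_le_iff c p ε _).2
    ⟨opt_nonneg c p, fun j => value_le_opt c p {j}, fun hbig => ?_⟩
  have hκ := scale_pos hc hp hε hbig
  have hrounded (S : Finset (Fin n)) :
      value (fun i => floorProfits c (scale c p ε (bigItems p)) i) p S ≤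
        opt c p / scale c p ε (bigItems p) := by
    rw [le_div_iff₀' hκ]
    exact (mul_value_floorProfits_le hκ (fun i => (hc i).le) (fun i => (hp i).le) S).trans
      (value_le_opt c p S)
  have hbound : 0 ≤ opt c p / scale c p ε (bigItems p) := div_nonneg (opt_nonneg c p) hκ.le
  simp only [← le_div_iff₀' hκ]
  refine ⟨fun j hj => ?_, ?_⟩ <;>
    refine scaledDP_val_le (fun i => (hp i).le) (nodup_bigItems p) hbound fun T hT => ?_
  · have hjT : j ∉ T := fun hjT =>
      (mem_smallItems.1 hj).not_ge (mem_bigItems.1 (List.mem_toFinset.1 (hT hjT)))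
    simpa only [value_insert _ p hjT] using hrounded (insert j T)
  · simpa only [value, Nat.cast_zero, add_zero, mul_one] using hrounded T

theorem mul_value_floorProfits_le_approxScheme_val (hc : ∀ i, 0 < c i) (hp : ∀ i, 0 < p i)
    (hε : 0 < ε) (hT : ∀ i ∈ T, 1 / 2 ≤ p i) (hne : T.Nonempty) :
    letI κ := scale c p ε (bigItems p)
    κ * value (fun i => floorProfits c κ i) p T ≤ (approxScheme c p ε).val ∧
      ∀ j, p j < 1 / 2 →
        κ * value (fun i => floorProfits c κ i) p (insert j T) ≤ (approxScheme c p ε).val := by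
  have hsub : T ⊆ (bigItems p).toFinset := fun i hi =>
    List.mem_toFinset.2 (mem_bigItems.2 (hT i hi))
  have hbig : bigItems p ≠ [] :=
    let ⟨_, hi⟩ := hne; List.ne_nil_of_mem (mem_bigItems.2 (hT _ hi))
  have hκ := scale_pos hc hp hε hbig
  have hdp (w : ℕ) {q : ℝ} (hq : 0 ≤ q) :=
    le_scaledDP_val (ch := floorProfits c (scale c p ε (bigItems p))) (fun i => (hp i).le)
      (nodup_bigItems p) w hq hsub hne
  obtain ⟨-, -, hcandidates⟩ := (approxScheme_val_le_iff c p ε _).1 le_rfl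
  obtain ⟨hsmall, hdummy⟩ := hcandidates hbig
  refine ⟨(mul_le_mul_of_nonneg_left ?_ hκ.le).trans hdummy, fun j hj =>
    (mul_le_mul_of_nonneg_left ?_ hκ.le).trans (hsmall j (mem_smallItems.2 hj))⟩
  · simpa only [value, Nat.cast_zero, add_zero, mul_one] using hdp 0 zero_le_one
  · rw [value_insert _ p fun hjT => hj.not_ge (hT j hjT)]
    exact hdp _ (hp j).le

theorem one_sub_mul_opt_le_approxScheme_val (hc : ∀ i, 0 < c i) (hp0 : ∀ i, 0 < p i)
    (hp1 : ∀ i, p i ≤ 1) (hε : 0 < ε) : (1 - ε) * opt c p ≤ (approxScheme c p ε).val := by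
  obtain ⟨S, hS⟩ := exists_value_eq_opt c p
  obtain ⟨T, hT, hST⟩ := exists_eq_or_eq_insert_of_value_eq_opt hc hp0 hS
  obtain ⟨hnonneg, hsingle, -⟩ := (approxScheme_val_le_iff c p ε _).1 le_rfl
  rcases T.eq_empty_or_nonempty with rfl | hne
  · have hexact : opt c p ≤ (approxScheme c p ε).val := by
      rcases hST with rfl | ⟨j, -, rfl⟩
      · rwa [← hS, value_empty]
      · exact hS ▸ hsingle j
    exact (mul_le_of_le_one_left (opt_nonneg c p) (by linarith)).trans hexact
  · have hbig : bigItems p ≠ [] :=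
      let ⟨_, hi⟩ := hne; List.ne_nil_of_mem (mem_bigItems.2 (hT _ hi))
    have hrounding := value_le_mul_value_floorProfits_add (c := c) (scale_pos hc hp0 hε hbig)
      (fun i => (hp0 i).le) hp1 S
    have hcandidate : scale c p ε (bigItems p) *
        value (fun i => floorProfits c (scale c p ε (bigItems p)) i) p S ≤
          (approxScheme c p ε).val := by
      obtain ⟨hdummy, hsmall⟩ :=
        mul_value_floorProfits_le_approxScheme_val hc hp0 hε hT hne
      rcases hST with rfl | ⟨j, hj, rfl⟩
      exacts [hdummy, hsmall j hj]
    linarith [natCast_mul_scale_le c p hε.le (bigItems p)]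

/-! ## The running time -/

theorem splitItems_steps_le (p : Fin n → ℝ) : (splitItems p).steps ≤ 4 * n := by
  refine (loop_steps_le _ _ (k := 3) fun i s => ?_).trans_eq
    (by rw [List.length_finRange, mul_comm])
  by_cases hi : 1 / 2 ≤ p i <;>
    simp only [Timed.bind_steps, readA, leR, step_val, step_steps, hi] <;> rfl

theorem loop_trySingle_steps_le (c p : Fin n → ℝ) (l : List (Fin n)) (z : ℝ) :
    (loop l z (trySingle c p)).steps ≤ l.length * 5 :=
  loop_steps_le l z fun _ _ => le_rfl

theorem scaleFactor_steps_le (c p : Fin n → ℝ) (ε : ℝ) (big : List (Fin n)) :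
    (scaleFactor c p ε big).steps ≤ big.length * 5 + 3 :=
  Nat.add_le_add_right (loop_trySingle_steps_le c p big 0) 3

theorem scaleProfits_steps_le (c : Fin n → ℝ) (κ : ℝ) : (scaleProfits c κ).steps ≤ n * 5 :=
  (loop_steps_le _ _ (k := 4) fun _ _ => le_rfl).trans_eq (by rw [List.length_finRange])

theorem sumProfits_steps_le (ch : Fin n → ℕ) (big : List (Fin n)) :
    (sumProfits ch big).steps ≤ big.length * 3 :=
  loop_steps_le big 0 fun _ _ => le_rfl

theorem minProfit_steps_le (ch : Fin n → ℕ) (big : List (Fin n)) (a : ℕ) :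
    (minProfit ch big a).steps ≤ big.length * 3 :=
  loop_steps_le big a fun _ _ => le_rfl

theorem initialRow_steps_le (B : ℕ) : (initialRow B).steps ≤ (B + 1) * 3 := by
  refine (loop_steps_le _ _ (k := 2) fun C row => ?_).trans_eq (by rw [List.length_range])
  by_cases hC : C = 0 <;> simp [leN, writeA, hC]

theorem dpStage_steps_le (ch : Fin n → ℕ) (p : Fin n → ℝ) (B : ℕ) (i : Fin n) (old : ℕ → ℝ) :
    (dpStage ch p B i old).steps ≤ (B + 1) * 8 + 2 := by
  simp only [dpStage, Timed.bind_steps, readA, step_steps, step_val]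
  rw [← add_assoc, add_comm]
  refine Nat.add_le_add_right ?_ 2
  refine (loop_steps_le _ _ (k := 7) fun C new => ?_).trans_eq (by rw [List.length_range])
  by_cases hC : ch i ≤ C <;> simp [leN, writeA, subN, mulR, maxR, hC]

theorem scaledDP_steps_le (ch : Fin n → ℕ) (p : Fin n → ℝ) (big : List (Fin n)) (w : ℕ) (q : ℝ) :
    (scaledDP ch p big w q).steps ≤ 17 * ((big.length + 1) * ((big.map ch).sum + 1)) := by
  rw [← sumProfits_val ch big]
  set B := (sumProfits ch big).val
  set lo := (minProfit ch big B).val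
  have hsum := sumProfits_steps_le ch big
  have hmin := minProfit_steps_le ch big B
  have hinit := initialRow_steps_le B
  have hstages := loop_steps_le big (initialRow B).val (dpStage_steps_le ch p B)
  have hcolumns : (loop (List.range' lo (B + 1 - lo)) 0
      (tryColumn (dpRow ch p big B) w q)).steps ≤ (B + 1 - lo) * 7 :=
    (loop_steps_le _ _ (k := 6) fun _ _ => le_rfl).trans_eq (by rw [List.length_range'])
  calc (scaledDP ch p big w q).steps
      ≤ big.length * 3 + (big.length * 3 + ((B + 1) * 3 +
          (big.length * ((B + 1) * 8 + 2 + 1) + (B + 1) * 7))) :=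
        add_le_add hsum (add_le_add hmin (add_le_add hinit (add_le_add hstages
          (hcolumns.trans (by gcongr; omega)))))
    _ ≤ 17 * ((big.length + 1) * (B + 1)) := by nlinarith [Nat.zero_le (big.length * B)]

theorem dpPhase_steps_le (c p : Fin n → ℝ) (ε : ℝ) (big small : List (Fin n)) (z : ℝ) :
    letI B := (big.map (floorProfits c (scale c p ε big))).sum
    (dpPhase c p ε big small z).steps ≤
      22 * ((small.length + 1) * ((big.length + 1) * (B + 1))) + 5 * big.length + 5 * n := by
  set κ := scale c p ε big
  set ch := floorProfits c κ with hch
  set W := (big.length + 1) * ((big.map ch).sum + 1)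
  have hW : 0 < W := by positivity
  have hscale := scaleFactor_steps_le c p ε big
  have hprofits := scaleProfits_steps_le c κ
  have hdp (w : ℕ) (q : ℝ) : (scaledDP ch p big w q).steps ≤ 17 * W :=
    scaledDP_steps_le ch p big w q
  have hloop : (loop small z (tryScaledDP κ ch p big)).steps ≤ small.length * (17 * W + 4 + 1) :=
    loop_steps_le small z fun j z => by
      have hj := hdp (ch j) (p j)
      simp only [tryScaledDP, Timed.bind_steps, readA, mulR, maxR, step_steps, step_val]
      omega
  rw [hch, ← scaleProfits_val] at hloop hdp
  calc (dpPhase c p ε big small z).steps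
      ≤ big.length * 5 + 3 + (n * 5 + (small.length * (17 * W + 4 + 1) + (17 * W + 2))) :=
        add_le_add hscale (add_le_add hprofits (add_le_add hloop (add_le_add_left (hdp 0 1) 2)))
    _ ≤ 22 * ((small.length + 1) * W) + 5 * big.length + 5 * n := by
        nlinarith [Nat.mul_le_mul_left small.length hW]

theorem approxScheme_steps_le (c p : Fin n → ℝ) (ε : ℝ) :
    letI B := ((bigItems p).map (floorProfits c (scale c p ε (bigItems p)))).sum
    (approxScheme c p ε).steps ≤ 63 * (n ^ 2 * (B + 1)) := by
  have hphase := dpPhase_steps_le c p ε (bigItems p) (smallItems p)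
  set B := ((bigItems p).map (floorProfits c (scale c p ε (bigItems p)))).sum
  have hlength := length_bigItems_add_length_smallItems p
  have hsplit := splitItems_steps_le p
  have hsmall := loop_trySingle_steps_le c p (smallItems p) 0
  have hbig := loop_trySingle_steps_le c p (bigItems p) (loop (smallItems p) 0 (trySingle c p)).val
  have hlinear : n ≤ n ^ 2 * (B + 1) := by nlinarith [Nat.le_self_pow two_ne_zero n]
  rw [approxScheme_eq]
  simp only [Timed.bind_steps]
  split_ifs with hnil
  · rw [Timed.pure_steps]
    omega
  · have hpos : 0 < (bigItems p).length := List.length_pos_iff.2 hnil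
    have hquadratic : (((smallItems p).length + 1) * (((bigItems p).length + 1) * (B + 1))) ≤
        2 * (n ^ 2 * (B + 1)) :=
      calc ((smallItems p).length + 1) * (((bigItems p).length + 1) * (B + 1))
          ≤ n * (2 * n * (B + 1)) := by gcongr <;> omega
        _ = 2 * (n ^ 2 * (B + 1)) := by ring
    exact (add_le_add hsplit (add_le_add hsmall (add_le_add hbig (hphase _)))).trans (by omega)

theorem approxScheme_steps_le_mul (hc : ∀ i, 0 < c i) (hp : ∀ i, 0 < p i) (hε : 0 < ε) :
    ((approxScheme c p ε).steps : ℝ) ≤ 63 * (n ^ 2 * (2 * n ^ 2 / ε + 1)) := by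
  have hsum := sum_floorProfits_bigItems_le hc hp hε
  calc ((approxScheme c p ε).steps : ℝ)
      ≤ 63 * (n ^ 2 *
          (((bigItems p).map (floorProfits c (scale c p ε (bigItems p)))).sum + 1)) := by
        exact_mod_cast approxScheme_steps_le c p ε
    _ ≤ 63 * (n ^ 2 * (2 * n ^ 2 / ε + 1)) := by gcongr

end Scheme

end AllOrNothing

theorem mainTheorem2 :
    ∃ K : ℝ, ∀ (n : ℕ) (c p : Fin n → ℝ) (ε : ℝ), 1 ≤ n → (∀ i, 0 < c i) →
      (∀ i, 0 < p i ∧ p i < 1) → 0 < ε →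
        (1 - ε) * AllOrNothing.opt c p ≤ (AllOrNothing.approxScheme c p ε).val ∧
        (AllOrNothing.approxScheme c p ε).val ≤ AllOrNothing.opt c p ∧
        (ε ≤ 1 → ((AllOrNothing.approxScheme c p ε).steps : ℝ) ≤ K * ((n : ℝ) ^ 4 / ε)) := by
  refine ⟨189, fun n c p ε hn hc hp hε => ?_⟩
  have hp0 (i : Fin n) : 0 < p i := (hp i).1
  have hp1 (i : Fin n) : p i ≤ 1 := (hp i).2.le
  refine ⟨AllOrNothing.one_sub_mul_opt_le_approxScheme_val hc hp0 hp1 hε,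
    AllOrNothing.approxScheme_val_le_opt hc hp0 hε, fun hε1 => ?_⟩
  have hcolumns : 1 ≤ (n : ℝ) ^ 2 / ε :=
    (one_le_div hε).2 (hε1.trans (one_le_pow₀ (Nat.one_le_cast.2 hn)))
  calc ((AllOrNothing.approxScheme c p ε).steps : ℝ)
      ≤ 63 * (n ^ 2 * (2 * n ^ 2 / ε + 1)) :=
        AllOrNothing.approxScheme_steps_le_mul hc hp0 hε
    _ ≤ 63 * (n ^ 2 * (2 * n ^ 2 / ε + n ^ 2 / ε)) := by gcongr
    _ = 189 * (n ^ 4 / ε) := by ring
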